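/- **HDXs are parity samplers.** Let $X(\le d)$ be a pure simplicial complex on a finite vertex set $X(1)$: a downward-closed family of vertex sets (faces) of size at most $d$, each contained in a face of size $d$; $X(i)$ denotes the set of faces of size $i$. Let $\Pi_d$ be a probability measure on $X(d)$, and for $i<d$ let $\Pi_i$ be the distribution on $X(i)$ obtained by drawing $\mathfrak s^{(d)}\sim\Pi_d$ and repeatedly passing from $\mathfrak s^{(j)}$ to a uniformly random subset $\mathfrak s^{(j-1)}$ of size $j-1$. For $\mathfrak s\in X(i)$ with $i\le d-2$, let $X_{\mathfrak s}=\{\mathfrak t\setminus\mathfrak s:\mathfrak s\subseteq\mathfrak t\in X\}$ be the link of $\mathfrak s$ and let $G(X_{\mathfrak s})$ be the weighted graph with vertex set $X_{\mathfrak s}(1)$ and edge set $X_{\mathfrak s}(2)$, in which the edge $\{u,v\}$ has weight $\Pi_{i+2}(\mathfrak s\cup\{u,v\})$. The complex is a *$\gamma$-HDX* if for all $0\le i\le d-2$ and all $\mathfrak s\in X(i)$ the second largest singular value of the normalized adjacency matrix of $G(X_{\mathfrak s})$ (with zero rows and columns at vertices of weighted degree zero) is at most $\gamma$. The *direct sum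 lifting* on $X(k)$ sends $z\in\mathbb F_2^{X(1)}$ to $y\in\mathbb F_2^{X(k)}$ with $y_{\mathfrak s}=\sum_{i\in\mathfrak s}z_i$. The *bias* of a word $y\in\mathbb F_2^{X(i)}$ is $\left|\mathbb E_{\mathfrak s\sim\Pi_i}(-1)^{y_{\mathfrak s}}\right|$, and the lifting is a *$(\beta_0,\beta)$-parity sampler* if every $z\in\mathbb F_2^{X(1)}$ of bias at most $\beta_0$ is sent to a word of bias at most $\beta$. There is a universal constant $C>0$ such that the following holds. Let $0<\beta\le\beta_0<1$, let $0<\theta<\frac1{\beta_0}-1$, and let $k$ and $d$ be natural numbers with $$k\ \ge\ \log_{(1+\theta)\beta_0}(\beta/3),\qquad d\ \ge\ \max\left\{\frac{3k^2}{\beta},\ \frac{6}{\theta^2\beta_0^2\beta}\right\}.$$ If $X(\le d)$, with the measure $\Pi_d$, is a $\gamma$-HDX with $\gamma\le C/d^2$, then the direct sum lifting on $X(k)$ is a $(\beta_0,\beta)$-parity sampler. -/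

import Mathlib

/-- A pure simplicial complex `X(≤ d)` with ground set `X(1) = V`.  Faces are graded by their
cardinality, and the empty set is allowed as a face. -/
structure PureComplex (V : Type*) (d : ℕ) where
  faces : Finset (Finset V)
  down_closed : ∀ s ∈ faces, ∀ t ⊆ s, t ∈ faces
  vertex_mem : ∀ v : V, {v} ∈ faces
  card_le : ∀ s ∈ faces, s.card ≤ d
  pure : ∀ s ∈ faces, ∃ t ∈ faces, s ⊆ t ∧ t.card = d

namespace PureComplex

variable {V : Type*} {d : ℕ}

/-- `X(i)`: the faces of cardinality `i`. -/
def level (X : PureComplex V d) (i : ℕ) : Finset (Finset V) :=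
  X.faces.filter fun s => s.card = i

/-- The faces of the link complex `X_s = { t \ s | s ⊆ t ∈ X }`. -/
def link [DecidableEq V] (X : PureComplex V d) (s : Finset V) : Finset (Finset V) :=
  (X.faces.filter fun t => s ⊆ t).image fun t => t \ s

/-- The vertices `X_s(1)` of the link complex of `s`. -/
abbrev LinkVertex [DecidableEq V] (X : PureComplex V d) (s : Finset V) : Type _ :=
  {v : V // {v} ∈ X.link s}

end PureComplex

/-- A pure simplicial complex `X(≤ d)` together with a probability measure `Π_d` on `X(d)`. -/
structure MeasuredComplex (V : Type*) (d : ℕ) extends PureComplex V d where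
  top : Finset V → ℝ
  top_nonneg : ∀ s, 0 ≤ top s
  top_eq_zero : ∀ s, s ∉ toPureComplex.level d → top s = 0
  top_sum : ∑ s ∈ toPureComplex.level d, top s = 1

noncomputable section

/-- The weighted degree of a vertex in the weighted graph with edge weights `W`. -/
def weightedDegree {U : Type*} [Fintype U] (W : Matrix U U ℝ) (u : U) : ℝ :=
  ∑ v, W u v

/-- The normalized adjacency matrix `D^(-1/2) W D^(-1/2)` of the weighted graph with edge
weights `W`; it does not change if `W` is rescaled, and a vertex of degree zero has zero row
and column. -/
def normalizedAdjacency {U : Type*} [Fintype U] (W : Matrix U U ℝ) : Matrix U U ℝ :=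
  Matrix.of fun u v => W u v / (√(weightedDegree W u) * √(weightedDegree W v))

/-- `σ₂` of a weighted graph: the second largest singular value, counted with multiplicity, of
its normalized adjacency matrix.  (The sequence `LinearMap.singularValues` is decreasing and
starts at index `0`.) -/
def secondSingularValue {U : Type*} [Fintype U] [DecidableEq U] (W : Matrix U U ℝ) : ℝ :=
  (Matrix.toEuclideanLin (normalizedAdjacency W)).singularValues 1

/-- The bias `|E_{a ∼ p} (-1)^{y a}|` of a binary word `y` whose positions are distributed
according to the weights `p`. -/
def bias {A : Type*} [Fintype A] (p : A → ℝ) (y : A → ZMod 2) : ℝ :=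
  |∑ a, p a * (-1 : ℝ) ^ (y a).val|

namespace MeasuredComplex

variable {V : Type*} [DecidableEq V] {d : ℕ}

/-- The marginal distribution of `s^(d - j)` in the random chain `s^(d), s^(d-1), …` in which
`s^(d)` is drawn from `Π_d` and `s^(i-1)` is a uniformly random subset of `s^(i)` of size
`i - 1`. -/
def chainMarginal (X : MeasuredComplex V d) : ℕ → Finset V → ℝ
  | 0, s => X.top s
  | j + 1, t =>
      ∑ s ∈ X.level (d - j),
        if t ∈ s.powersetCard (d - (j + 1)) then
          X.chainMarginal j s / ((s.powersetCard (d - (j + 1))).card : ℝ)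
        else 0

/-- The probability measure `Π_i` on `X(i)`, for `i ≤ d`. -/
def levelMeasure (X : MeasuredComplex V d) (i : ℕ) (s : Finset V) : ℝ :=
  X.chainMarginal (d - i) s

/-- The skeleton `G(X_s)` of the link of `s`: its vertices are `X_s(1)`, its edges are `X_s(2)`,
and the weight of an edge `{u, v}` is `Π_{|s|+2}(s ∪ {u, v})`. -/
def skeletonWeight (X : MeasuredComplex V d) (s : Finset V) :
    Matrix (X.LinkVertex s) (X.LinkVertex s) ℝ :=
  Matrix.of fun u v =>
    if u ≠ v ∧ ({u.1, v.1} : Finset V) ∈ X.link s then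
      X.levelMeasure (s.card + 2) (s ∪ {u.1, v.1})
    else 0

/-- `X(≤ d)` is a `γ`-high-dimensional expander: for all `0 ≤ i ≤ d - 2` and all `s ∈ X(i)`, the
skeleton of the link of `s` has second largest singular value at most `γ`. -/
def IsHDX [Fintype V] (X : MeasuredComplex V d) (γ : ℝ) : Prop :=
  ∀ i : ℕ, i + 2 ≤ d → ∀ s ∈ X.level i, secondSingularValue (X.skeletonWeight s) ≤ γ

/-- The direct sum lifting on `X(k)`. -/
def directSum (X : MeasuredComplex V d) (k : ℕ) (z : V → ZMod 2) : X.level k → ZMod 2 :=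
  fun s => ∑ v ∈ s.1, z v

/-- A lifting from words on `X(1)` to words on `X(k)` is a `(β₀, β)`-parity sampler if it maps
words of bias at most `β₀` to words of bias at most `β`.  The positions of words on `X(i)` are
weighted by `Π_i`. -/
def IsParitySampler [Fintype V] (X : MeasuredComplex V d) (k : ℕ)
    (lift : (V → ZMod 2) → (X.level k → ZMod 2)) (β₀ β : ℝ) : Prop :=
  ∀ z : V → ZMod 2,
    bias (fun v : V => X.levelMeasure 1 {v}) z ≤ β₀ →
      bias (fun s : X.level k => X.levelMeasure k s.1) (lift z) ≤ β

end MeasuredComplex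

end

open Finset

/-! Write `f v = (-1)^(z v)` and let `μ` be its mean under `Π_1`, so `|μ| ≤ β₀`. A face drawn from
`Π_k` is a uniform `k`-subset of a facet `s` drawn from `Π_d`. Let `a s` be the mean of `f` over
`s`. Three errors of size `β/3` make up the bias of the lifted word.

Inside a facet, sampling `k` vertices without replacement costs at most `k(k-1)/d` against the value
`(a s)^k` for independent vertices (`abs_average_prod_powersetCard_sub_pow_le`).

Across facets, `a s` has variance at most `1/d + γ` (`variance_facetAverage_le`): a uniform pair in
a random facet is a random edge of the graph `G(X_∅)`, whose expansion bounds the correlation of the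
two signs. By Chebyshev, `|a s - μ| > θβ₀` has probability at most `β/3`.

On the remaining facets `|a s| ≤ (1+θ)β₀`, and the choice of `k` makes the `k`-th power at most
`β/3`. -/

/-! ### Sampling with and without replacement -/

/-- Expand the product over pairs `(v, t)`. If `v ∉ t`, the pair yields the set `insert v t`, which
arises once for each of its `k + 1` elements; the pairs with `v ∈ t` are the collisions. -/
theorem Finset.sum_mul_sum_prod_powersetCard {V : Type*} [DecidableEq V] (s : Finset V)
    (f : V → ℝ) (k : ℕ) :
    (∑ v ∈ s, f v) * ∑ t ∈ s.powersetCard k, ∏ v ∈ t, f v =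
      (k + 1) * ∑ t ∈ s.powersetCard (k + 1), ∏ v ∈ t, f v +
        ∑ t ∈ s.powersetCard k, ∑ v ∈ t, f v * ∏ u ∈ t, f u := by
  have hsplit : (∑ v ∈ s, f v) * ∑ t ∈ s.powersetCard k, ∏ v ∈ t, f v =
      ∑ t ∈ s.powersetCard k, ∑ v ∈ s \ t, f v * ∏ u ∈ t, f u +
        ∑ t ∈ s.powersetCard k, ∑ v ∈ t, f v * ∏ u ∈ t, f u := by
    rw [← sum_add_distrib, mul_sum]
    refine sum_congr rfl fun t ht => ?_
    rw [sum_mul, sum_sdiff (mem_powersetCard.1 ht).1]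
  have hcount : ((k : ℝ) + 1) * ∑ t ∈ s.powersetCard (k + 1), ∏ v ∈ t, f v =
      ∑ t ∈ s.powersetCard (k + 1), ∑ _v ∈ t, ∏ u ∈ t, f u := by
    rw [mul_sum]
    refine sum_congr rfl fun t ht => ?_
    rw [sum_const, (mem_powersetCard.1 ht).2]
    simp
  rw [hsplit, hcount]
  congr 1
  rw [sum_sigma', sum_sigma']
  refine sum_bij' (fun p _ => ⟨insert p.2 p.1, p.2⟩) (fun p _ => ⟨p.1.erase p.2, p.2⟩)
    ?_ ?_ ?_ ?_ ?_
  · rintro ⟨t, v⟩ h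
    simp only [mem_sigma, mem_powersetCard, mem_sdiff] at h ⊢
    exact ⟨⟨insert_subset h.2.1 h.1.1, by rw [card_insert_of_notMem h.2.2, h.1.2]⟩,
      mem_insert_self _ _⟩
  · rintro ⟨t, v⟩ h
    simp only [mem_sigma, mem_powersetCard, mem_sdiff] at h ⊢
    exact ⟨⟨(erase_subset _ _).trans h.1.1, by rw [card_erase_of_mem h.2, h.1.2]; rfl⟩,
      h.1.1 h.2, notMem_erase _ _⟩
  · rintro ⟨t, v⟩ h
    simp only [mem_sigma, mem_powersetCard, mem_sdiff] at h
    simp [erase_insert h.2.2]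
  · rintro ⟨t, v⟩ h
    simp only [mem_sigma, mem_powersetCard] at h
    simp [insert_erase h.2]
  · rintro ⟨t, v⟩ h
    simp only [mem_sigma, mem_powersetCard, mem_sdiff] at h
    simp [prod_insert h.2.2]

/-- Sampling `k` elements of a set of size `d` without replacement changes the expected product
by at most `k (k - 1) / d` compared with sampling with replacement. -/
theorem abs_average_prod_powersetCard_sub_pow_le {V : Type*} [DecidableEq V] {d : ℕ}
    (s : Finset V) (hs : s.card = d) (f : V → ℝ) (hf : ∀ v, |f v| ≤ 1) (k : ℕ) (hk : k ≤ d) :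
    |(∑ t ∈ s.powersetCard k, ∏ v ∈ t, f v) / (d.choose k : ℝ) - ((∑ v ∈ s, f v) / d) ^ k| ≤
      k * (k - 1) / d := by
  have hprod (t : Finset V) : |∏ v ∈ t, f v| ≤ 1 := by
    rw [abs_prod]; exact prod_le_one (fun _ _ => abs_nonneg _) fun v _ => hf v
  have hav (k : ℕ) (hk : k ≤ d) :
      |(∑ t ∈ s.powersetCard k, ∏ v ∈ t, f v) / (d.choose k : ℝ)| ≤ 1 := by
    have hc : (0 : ℝ) < d.choose k := by exact_mod_cast Nat.choose_pos hk
    rw [abs_div, abs_of_pos hc, div_le_one hc]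
    refine (abs_sum_le_sum_abs _ _).trans ((sum_le_sum fun t _ => hprod t).trans ?_)
    simp [hs]
  have ha : |(∑ v ∈ s, f v) / (d : ℝ)| ≤ 1 := by
    rw [abs_div, Nat.abs_cast]
    refine div_le_one_of_le₀ ?_ (by positivity)
    refine (abs_sum_le_sum_abs _ _).trans ((sum_le_sum fun t _ => hf t).trans ?_)
    simp [hs]
  induction k with
  | zero => simp
  | succ k ih =>
    specialize ih (by omega)
    have hd : (0 : ℝ) < d := by exact_mod_cast (by omega : 0 < d)
    have hc : (0 : ℝ) < d.choose k := by exact_mod_cast Nat.choose_pos (by omega : k ≤ d)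
    have hc' : (0 : ℝ) < d.choose (k + 1) := by exact_mod_cast Nat.choose_pos hk
    set a := (∑ v ∈ s, f v) / (d : ℝ) with ha_def
    set e := ∑ t ∈ s.powersetCard k, ∏ v ∈ t, f v with he
    set e' := ∑ t ∈ s.powersetCard (k + 1), ∏ v ∈ t, f v with he'
    set R := ∑ t ∈ s.powersetCard k, ∑ v ∈ t, f v * ∏ u ∈ t, f u with hR_def
    have hid : d * a * e = (k + 1) * e' + R := by
      rw [ha_def, mul_div_cancel₀ _ hd.ne']
      exact sum_mul_sum_prod_powersetCard s f k
    have hR : |R| ≤ k * d.choose k := by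
      calc |R| ≤ ∑ t ∈ s.powersetCard k, (k : ℝ) := by
            refine (abs_sum_le_sum_abs _ _).trans (sum_le_sum fun t ht => ?_)
            calc _ ≤ ∑ v ∈ t, |f v * ∏ u ∈ t, f u| := abs_sum_le_sum_abs _ _
              _ ≤ ∑ v ∈ t, (1 : ℝ) := sum_le_sum fun v _ => by
                  rw [abs_mul]
                  exact mul_le_one₀ (hf v) (abs_nonneg _) (hprod t)
              _ = k := by simp [(mem_powersetCard.1 ht).2]
        _ = _ := by simp [hs, mul_comm]
    have hch : ((k : ℝ) + 1) * d.choose (k + 1) = (d - k) * d.choose k := by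
      have := Nat.choose_succ_right_eq d k
      have h2 : ((d.choose (k + 1) * (k + 1) : ℕ) : ℝ) = ((d.choose k * (d - k) : ℕ) : ℝ) := by
        rw [this]
      push_cast [Nat.cast_sub (by omega : k ≤ d)] at h2
      linarith
    set E := e / (d.choose k : ℝ) with hE
    set E' := e' / (d.choose (k + 1) : ℝ) with hE'
    -- This is `hid` divided by `d * d.choose k`. Both terms on the right are at most `k / d` in
    -- absolute value, and the increments `2j/d` for `j < k` add up to `k(k-1)/d`.
    have hid' : E' - a * E = k / d * E' - R / (d * d.choose k) := by
      have h1 : e = E * d.choose k := by rw [hE]; field_simp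
      have h2 : e' = E' * d.choose (k + 1) := by rw [hE']; field_simp
      rw [h1, h2] at hid
      field_simp
      have : (k + 1) * (E' * (d.choose (k + 1) : ℝ)) = E' * ((d - k) * d.choose k) := by
        rw [← hch]; ring
      linarith
    have hstep : |E' - a * E| ≤ 2 * k / d := by
      rw [hid']
      have h1 : |k / d * E'| ≤ (k : ℝ) / d := by
        rw [abs_mul, abs_of_nonneg (by positivity : (0 : ℝ) ≤ k / d)]
        exact mul_le_of_le_one_right (by positivity) (hav _ hk)
      have h2 : |R / (d * d.choose k)| ≤ (k : ℝ) / d := by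
        rw [abs_div, abs_of_pos (by positivity : (0 : ℝ) < d * d.choose k),
          div_le_div_iff₀ (by positivity) hd]
        nlinarith
      calc _ ≤ _ := abs_sub _ _
        _ ≤ (k : ℝ) / d + k / d := add_le_add h1 h2
        _ = _ := by ring
    have hlast : |a * (E - a ^ k)| ≤ k * (k - 1) / d := by
      rw [abs_mul]
      exact (mul_le_of_le_one_left (abs_nonneg _) ha).trans ih
    calc |E' - a ^ (k + 1)| = |(E' - a * E) + a * (E - a ^ k)| := by congr 1; ring
      _ ≤ 2 * k / d + k * (k - 1) / d := (abs_add_le _ _).trans (add_le_add hstep hlast)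
      _ = _ := by push_cast; ring

/-! ### Second singular value and quadratic forms -/

open scoped InnerProductSpace

/-- A linear map stretches a vector orthogonal to the top right-singular vector by at most its
second largest singular value. -/
theorem LinearMap.exists_norm_apply_le_singularValues_one {E : Type*} [NormedAddCommGroup E]
    [InnerProductSpace ℝ E] [FiniteDimensional ℝ E] (T : E →ₗ[ℝ] E) :
    ∃ e : E, ∀ x : E, ⟪e, x⟫_ℝ = 0 → ‖T x‖ ^ 2 ≤ T.singularValues 1 ^ 2 * ‖x‖ ^ 2 := by
  -- An eigenbasis of `T* T`, whose eigenvalues are the squared singular values in decreasing order.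
  -- The vector `e` is its first element.
  set b := T.isSymmetric_adjoint_comp_self.eigenvectorBasis rfl with hb
  by_cases h0 : 0 < Module.finrank ℝ E
  · refine ⟨b ⟨0, h0⟩, fun x hx => ?_⟩
    have h1 : ‖T x‖ ^ 2 =
        ∑ i, T.isSymmetric_adjoint_comp_self.eigenvalues rfl i * ⟪b i, x⟫_ℝ ^ 2 := by
      rw [← real_inner_self_eq_norm_sq, ← LinearMap.adjoint_inner_left,
        ← b.sum_inner_mul_inner]
      refine sum_congr rfl fun i _ => ?_
      have : ⟪T.adjoint (T x), b i⟫_ℝ =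
          T.isSymmetric_adjoint_comp_self.eigenvalues rfl i * ⟪b i, x⟫_ℝ := by
        have h := T.isSymmetric_adjoint_comp_self x (b i)
        rw [hb, T.isSymmetric_adjoint_comp_self.apply_eigenvectorBasis] at h
        rw [LinearMap.comp_apply] at h
        rw [hb, h, inner_smul_right, real_inner_comm]
        simp
      rw [this]; ring
    have h2 : ‖x‖ ^ 2 = ∑ i, ⟪b i, x⟫_ℝ ^ 2 := by
      rw [← real_inner_self_eq_norm_sq, ← b.sum_inner_mul_inner]
      exact sum_congr rfl fun i _ => by rw [real_inner_comm]; ring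
    rw [h1, h2, mul_sum]
    refine sum_le_sum fun i _ => ?_
    rcases Nat.eq_zero_or_pos i.1 with hi | hi
    · have : i = ⟨0, h0⟩ := Fin.ext hi
      rw [this, hx]; simp
    · rw [← T.sq_singularValues_fin rfl i]
      exact mul_le_mul_of_nonneg_right (pow_le_pow_left₀ (T.singularValues_nonneg _)
        (T.singularValues_antitone hi) 2) (sq_nonneg _)
  · refine ⟨0, fun x _ => ?_⟩
    have := Module.finrank_zero_iff.1 (by omega : Module.finrank ℝ E = 0)
    simp [Subsingleton.elim x 0]

/-- The top singular vector `e` need not be the fixed vector `w`. However, some nonzero combination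
of `w` and `g` is orthogonal to `e`, hence is shrunk by `σ < 1`. Its `w`-part is not shrunk and
stays orthogonal to the image of its `g`-part, so the `g`-part must be shrunk by at least `σ`. -/
theorem LinearMap.IsSymmetric.norm_apply_le_singularValues_one {E : Type*} [NormedAddCommGroup E]
    [InnerProductSpace ℝ E] [FiniteDimensional ℝ E] {T : E →ₗ[ℝ] E} (hT : T.IsSymmetric)
    (hσ : T.singularValues 1 < 1) {w : E} (hw : w ≠ 0) (hTw : T w = w) {g : E}
    (hg : ⟪w, g⟫_ℝ = 0) : ‖T g‖ ≤ T.singularValues 1 * ‖g‖ := by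
  obtain ⟨e, he⟩ := T.exists_norm_apply_le_singularValues_one
  have hσ0 := T.singularValues_nonneg 1
  set σ := T.singularValues 1
  have hσ2 : σ ^ 2 < 1 := by nlinarith
  have hw0 : 0 < ‖w‖ ^ 2 := by positivity
  have hTg : ⟪w, T g⟫_ℝ = 0 := by rw [← hT, hTw, hg]
  have key (a b : ℝ) (h : ⟪e, a • w + b • g⟫_ℝ = 0) :
      a ^ 2 * ‖w‖ ^ 2 + b ^ 2 * ‖T g‖ ^ 2 ≤ σ ^ 2 * (a ^ 2 * ‖w‖ ^ 2 + b ^ 2 * ‖g‖ ^ 2) := by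
    have := he _ h
    rw [map_add, map_smul, map_smul, hTw, norm_add_sq_real, norm_add_sq_real] at this
    simpa [inner_smul_left, inner_smul_right, hg, hTg, norm_smul, mul_pow] using this
  rw [← abs_of_nonneg (norm_nonneg (T g)), ← abs_of_nonneg (by positivity : 0 ≤ σ * ‖g‖),
    ← sq_le_sq, mul_pow]
  -- Here `w` itself would be shrunk, contradicting `T w = w ≠ 0`.
  by_cases hew : ⟪e, w⟫_ℝ = 0
  · have := key 1 0 (by simp [hew])
    nlinarith
  · have h := key (-⟪e, g⟫_ℝ) ⟪e, w⟫_ℝ (by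
      rw [inner_add_right, inner_smul_right, inner_smul_right]; ring)
    have hpos : 0 < ⟪e, w⟫_ℝ ^ 2 := by positivity
    have h3 : 0 ≤ (1 - σ ^ 2) * (⟪e, g⟫_ℝ ^ 2 * ‖w‖ ^ 2) :=
      mul_nonneg (by linarith) (by positivity)
    have : ⟪e, w⟫_ℝ ^ 2 * ‖T g‖ ^ 2 ≤ ⟪e, w⟫_ℝ ^ 2 * (σ ^ 2 * ‖g‖ ^ 2) := by nlinarith
    exact le_of_mul_le_mul_left this hpos

/-- The quadratic form of a weighted graph on functions orthogonal to the constants. -/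
theorem quadraticForm_le_of_secondSingularValue_le {U : Type*} [Fintype U] [DecidableEq U]
    (W : Matrix U U ℝ) (hsymm : ∀ u v, W u v = W v u) (hnonneg : ∀ u v, 0 ≤ W u v) {γ : ℝ}
    (hγ : γ < 1) (hσ : secondSingularValue W ≤ γ) (h : U → ℝ)
    (hh : ∑ u, weightedDegree W u * h u = 0) :
    ∑ u, ∑ v, W u v * (h u * h v) ≤ γ * ∑ u, weightedDegree W u * h u ^ 2 := by
  have hdeg (u : U) : 0 ≤ weightedDegree W u := sum_nonneg fun v _ => hnonneg u v
  have hW0 (u v : U) (hu : weightedDegree W u = 0) : W u v = 0 :=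
    (sum_eq_zero_iff_of_nonneg fun v _ => hnonneg u v).1 hu v (mem_univ v)
  by_cases hall : ∀ u, weightedDegree W u = 0
  · simp [hall, fun u v => hW0 u v (hall u)]
  push Not at hall
  obtain ⟨u₀, hu₀⟩ := hall
  have hAW (u v : U) : √(weightedDegree W u) * √(weightedDegree W v) *
      normalizedAdjacency W u v = W u v := by
    rw [normalizedAdjacency, Matrix.of_apply]
    by_cases hu : weightedDegree W u = 0
    · simp [hW0 u v hu]
    by_cases hv : weightedDegree W v = 0
    · simp [hsymm u v, hW0 v u hv]
    have h1 : √(weightedDegree W u) ≠ 0 := Real.sqrt_ne_zero'.2 ((hdeg u).lt_of_ne' hu)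
    have h2 : √(weightedDegree W v) ≠ 0 := Real.sqrt_ne_zero'.2 ((hdeg v).lt_of_ne' hv)
    field_simp
  set T := Matrix.toEuclideanLin (normalizedAdjacency W) with hT_def
  have hherm : (normalizedAdjacency W).IsHermitian := by
    ext u v
    simp [normalizedAdjacency, hsymm u v, mul_comm]
  have hT : T.IsSymmetric := Matrix.isSymmetric_toEuclideanLin_iff.2 hherm
  -- Rescaling by square roots of degrees turns the constant function into the fixed vector `w`, and
  -- `h` into a vector `g` orthogonal to it.
  set w : EuclideanSpace ℝ U := WithLp.toLp 2 fun u => √(weightedDegree W u) with hw_def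
  set g : EuclideanSpace ℝ U := WithLp.toLp 2 fun u => √(weightedDegree W u) * h u with hg_def
  have hw : w ≠ 0 := fun h0 => hu₀ <| by
    have := congrArg (fun x : EuclideanSpace ℝ U => x u₀) h0
    simpa [hw_def, Real.sqrt_eq_zero (hdeg u₀)] using this
  have hTw : T w = w := by
    ext u
    simp only [hT_def, hw_def, Matrix.toLpLin_apply, Matrix.mulVec, dotProduct]
    by_cases hu : weightedDegree W u = 0
    · simp [normalizedAdjacency, hu]
    have h1 : √(weightedDegree W u) ≠ 0 := Real.sqrt_ne_zero'.2 ((hdeg u).lt_of_ne' hu)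
    apply mul_left_cancel₀ h1
    rw [Real.mul_self_sqrt (hdeg u), mul_sum]
    exact sum_congr rfl fun v _ => by rw [← hAW u v]; ring
  have hwg : ⟪w, g⟫_ℝ = 0 := by
    rw [← hh, hw_def, hg_def, PiLp.inner_apply]
    refine sum_congr rfl fun u _ => ?_
    simp only [RCLike.inner_apply, conj_trivial]
    rw [mul_right_comm, Real.mul_self_sqrt (hdeg u)]
  have hgn : ‖g‖ ^ 2 = ∑ u, weightedDegree W u * h u ^ 2 := by
    rw [EuclideanSpace.norm_sq_eq]
    refine sum_congr rfl fun u _ => ?_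
    simp [hg_def, mul_pow, Real.sq_sqrt (hdeg u)]
  have hgT : ⟪g, T g⟫_ℝ = ∑ u, ∑ v, W u v * (h u * h v) := by
    rw [PiLp.inner_apply]
    refine sum_congr rfl fun u _ => ?_
    simp only [hT_def, hg_def, Matrix.toLpLin_apply, Matrix.mulVec, dotProduct,
      RCLike.inner_apply, conj_trivial, sum_mul]
    exact sum_congr rfl fun v _ => by rw [← hAW u v]; ring
  have hnorm := hT.norm_apply_le_singularValues_one (lt_of_le_of_lt hσ hγ) hw hTw hwg
  rw [← hgT, ← hgn]
  calc ⟪g, T g⟫_ℝ ≤ ‖g‖ * ‖T g‖ := real_inner_le_norm _ _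
    _ ≤ ‖g‖ * (γ * ‖g‖) := by
        gcongr
        exact hnorm.trans (mul_le_mul_of_nonneg_right hσ (norm_nonneg _))
    _ = γ * ‖g‖ ^ 2 := by ring

/-! ### Level measures as averages over facets -/

namespace MeasuredComplex

variable {V : Type*} {d : ℕ}

theorem card_of_mem_level (X : MeasuredComplex V d) {i : ℕ} {s : Finset V} (hs : s ∈ X.level i) :
    s.card = i :=
  (mem_filter.1 hs).2

theorem mem_level_of_subset (X : MeasuredComplex V d) {i : ℕ} {s t : Finset V}
    (hs : s ∈ X.level i) (hts : t ⊆ s) : t ∈ X.level t.card :=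
  mem_filter.2 ⟨X.down_closed s (mem_filter.1 hs).1 t hts, rfl⟩

variable [DecidableEq V]

/-- Deleting uniformly random elements one at a time leaves a uniform subset of the facet. In the
induction, exactly `j + 1` sets of size `d - j` lie between `t` and a facet containing it. -/
theorem chainMarginal_eq (X : MeasuredComplex V d) (j : ℕ) (hj : j ≤ d) (t : Finset V)
    (ht : t.card = d - j) :
    X.chainMarginal j t =
      (∑ s ∈ X.level d, if t ⊆ s then X.top s else 0) / (d.choose (d - j) : ℝ) := by
  induction j generalizing t with
  | zero =>
    have h (s) (hs : s ∈ X.level d) : (if t ⊆ s then X.top s else 0) =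
        if t = s then X.top s else 0 := by
      by_cases hts : t ⊆ s
      · have : t = s := eq_of_subset_of_card_le hts (by rw [X.card_of_mem_level hs, ht]; simp)
        simp [this]
      · have : t ≠ s := fun h => hts h.subset
        simp [this, hts]
    rw [sum_congr rfl h, sum_ite_eq]
    by_cases hmem : t ∈ X.level d
    · simp [chainMarginal, hmem]
    · simp [chainMarginal, hmem, X.top_eq_zero t hmem]
  | succ j ih =>
    have hdj : d - j = d - (j + 1) + 1 := by omega
    have hpos : (0 : ℝ) < (d - j : ℕ) := by exact_mod_cast (by omega : 0 < d - j)
    have hterm (s) (hs : s ∈ X.level (d - j)) :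
        (if t ∈ s.powersetCard (d - (j + 1)) then
          X.chainMarginal j s / ((s.powersetCard (d - (j + 1))).card : ℝ) else 0) =
        ∑ r ∈ X.level d, if t ⊆ s ∧ s ⊆ r then
          X.top r / ((d.choose (d - j) : ℝ) * (d - j : ℕ)) else 0 := by
      by_cases hts : t ⊆ s
      · have hc : (s.powersetCard (d - (j + 1))).card = d - j := by
          rw [card_powersetCard, X.card_of_mem_level hs, hdj, Nat.choose_succ_self_right]
        rw [if_pos (mem_powersetCard.2 ⟨hts, ht⟩), hc,
          ih (by omega) s (X.card_of_mem_level hs), div_div, sum_div]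
        refine sum_congr rfl fun r _ => ?_
        by_cases hsr : s ⊆ r <;> simp [hts, hsr]
      · simp [hts, mem_powersetCard]
    have hchoose : (d.choose (d - j) : ℝ) * (d - j : ℕ) =
        d.choose (d - (j + 1)) * (j + 1 : ℕ) := by
      have h := Nat.choose_succ_right_eq d (d - (j + 1))
      rw [← hdj, show d - (d - (j + 1)) = j + 1 by omega] at h
      exact_mod_cast h
    rw [chainMarginal, sum_congr rfl hterm, sum_comm, sum_div]
    refine sum_congr rfl fun r hr => ?_
    by_cases htr : t ⊆ r
    · have hset : (X.level (d - j)).filter (fun s => t ⊆ s ∧ s ⊆ r) =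
          (r.powersetCard (d - j)).filter (t ⊆ ·) := by
        ext s
        simp only [mem_filter, mem_powersetCard]
        constructor
        · rintro ⟨hs, hts, hsr⟩
          exact ⟨⟨hsr, X.card_of_mem_level hs⟩, hts⟩
        · rintro ⟨⟨hsr, hs⟩, hts⟩
          exact ⟨hs ▸ X.mem_level_of_subset hr hsr, hts, hsr⟩
      rw [← sum_filter, hset, sum_const,
        card_filter_powersetCard_subset t r (d - j) htr (by omega), X.card_of_mem_level hr, ht,
        show d - (d - (j + 1)) = j + 1 by omega, show d - j - (d - (j + 1)) = 1 by omega,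
        Nat.choose_one_right, nsmul_eq_mul, hchoose, if_pos htr]
      have h1 : ((j + 1 : ℕ) : ℝ) ≠ 0 := by positivity
      rw [mul_div_assoc', mul_comm (d.choose _ : ℝ), mul_div_mul_left _ _ h1]
    · rw [if_neg htr, zero_div]
      refine sum_eq_zero fun s _ => if_neg fun h => htr (h.1.trans h.2)

theorem levelMeasure_eq (X : MeasuredComplex V d) {i : ℕ} (hi : i ≤ d) {t : Finset V}
    (ht : t.card = i) :
    X.levelMeasure i t =
      (∑ s ∈ X.level d, if t ⊆ s then X.top s else 0) / (d.choose i : ℝ) := by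
  have h := X.chainMarginal_eq (d - i) (by omega) t (by omega)
  rwa [show d - (d - i) = i by omega] at h

/-- Averages over `Π_i` are averages, over a facet drawn from `Π_d`, of the average over its
subsets of size `i`. -/
theorem sum_levelMeasure_mul (X : MeasuredComplex V d) {i : ℕ} (hi : i ≤ d)
    (F : Finset V → ℝ) :
    ∑ t ∈ X.level i, X.levelMeasure i t * F t =
      ∑ s ∈ X.level d, X.top s * ((∑ t ∈ s.powersetCard i, F t) / (d.choose i : ℝ)) := by
  have h (t) (ht : t ∈ X.level i) : X.levelMeasure i t * F t =
      ∑ s ∈ X.level d, if t ⊆ s then X.top s * (F t / (d.choose i : ℝ)) else 0 := by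
    rw [X.levelMeasure_eq hi (X.card_of_mem_level ht), div_mul_eq_mul_div, mul_div_assoc, sum_mul]
    exact sum_congr rfl fun s _ => by split_ifs <;> simp
  rw [sum_congr rfl h, sum_comm]
  refine sum_congr rfl fun s hs => ?_
  have hset : (X.level i).filter (· ⊆ s) = s.powersetCard i := by
    ext t
    simp only [mem_filter, mem_powersetCard]
    constructor
    · rintro ⟨ht, hts⟩
      exact ⟨hts, X.card_of_mem_level ht⟩
    · rintro ⟨hts, ht⟩
      exact ⟨ht ▸ X.mem_level_of_subset hs hts, hts⟩
  rw [← sum_filter, hset, sum_div, mul_sum]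

theorem sum_levelMeasure_one_mul [Fintype V] (X : MeasuredComplex V d) (hd : 1 ≤ d)
    (F : V → ℝ) :
    ∑ v, X.levelMeasure 1 {v} * F v = ∑ s ∈ X.level d, X.top s * ((∑ v ∈ s, F v) / d) := by
  have h (v : V) : X.levelMeasure 1 {v} * F v =
      ∑ s ∈ X.level d, if v ∈ s then X.top s * (F v / d) else 0 := by
    rw [X.levelMeasure_eq hd (card_singleton v), Nat.choose_one_right, div_mul_eq_mul_div,
      mul_div_assoc, sum_mul]
    exact sum_congr rfl fun s _ => by
      simp only [singleton_subset_iff]; split_ifs <;> simp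
  simp_rw [h]
  rw [sum_comm]
  refine sum_congr rfl fun s _ => ?_
  rw [← sum_filter, sum_div, mul_sum]
  simp

/-! ### The graph of the empty face and the variance of facet averages -/

theorem singleton_mem_link_empty (X : MeasuredComplex V d) (v : V) : {v} ∈ X.link ∅ :=
  mem_image.2 ⟨{v}, mem_filter.2 ⟨X.vertex_mem v, empty_subset _⟩, sdiff_empty⟩

/-- The edge test can be dropped: a pair that is not a face lies in no facet, and `erase` makes the
diagonal vanish. -/
theorem skeletonWeight_empty (X : MeasuredComplex V d) (hd : 2 ≤ d) (u v : X.LinkVertex ∅) :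
    X.skeletonWeight ∅ u v =
      ∑ s ∈ X.level d, if u.1 ∈ s ∧ v.1 ∈ s.erase u.1 then
        X.top s / (d.choose 2 : ℝ) else 0 := by
  rw [skeletonWeight, Matrix.of_apply]
  by_cases huv : u = v
  · simp [huv]
  have huv' : u.1 ≠ v.1 := fun h => huv (Subtype.ext h)
  have hiff (s : Finset V) : (u.1 ∈ s ∧ v.1 ∈ s.erase u.1) ↔ ({u.1, v.1} : Finset V) ⊆ s := by
    simp [insert_subset_iff, huv'.symm]
  simp_rw [hiff]
  split_ifs with h
  · rw [card_empty, empty_union, zero_add, X.levelMeasure_eq hd (card_pair huv'), sum_div]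
    exact sum_congr rfl fun s _ => by split_ifs <;> simp
  · refine (sum_eq_zero fun s hs => if_neg fun hsub => h ⟨huv, ?_⟩).symm
    exact mem_image.2 ⟨{u.1, v.1}, mem_filter.2
      ⟨X.down_closed s (mem_filter.1 hs).1 _ hsub, empty_subset _⟩, sdiff_empty⟩

theorem sum_skeletonWeight_empty_mul [Fintype V] (X : MeasuredComplex V d) (hd : 2 ≤ d)
    (F : V → V → ℝ) :
    ∑ u : X.LinkVertex ∅, ∑ v : X.LinkVertex ∅, X.skeletonWeight ∅ u v * F u.1 v.1 =
      ∑ s ∈ X.level d, X.top s *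
        ((∑ u ∈ s, ∑ v ∈ s.erase u, F u v) / (d.choose 2 : ℝ)) := by
  let e : X.LinkVertex ∅ ≃ V := Equiv.subtypeUnivEquiv X.singleton_mem_link_empty
  have h1 : ∑ u : X.LinkVertex ∅, ∑ v : X.LinkVertex ∅, X.skeletonWeight ∅ u v * F u.1 v.1 =
      ∑ u : V, ∑ v : V, ∑ s ∈ X.level d, if u ∈ s ∧ v ∈ s.erase u then
        X.top s * (F u v / (d.choose 2 : ℝ)) else 0 := by
    refine Fintype.sum_equiv e _ _ fun u => Fintype.sum_equiv e _ _ fun v => ?_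
    rw [X.skeletonWeight_empty hd, sum_mul]
    refine sum_congr rfl fun s _ => ?_
    simp only [e, Equiv.subtypeUnivEquiv_apply]
    split_ifs
    · ring
    · simp
  rw [h1]
  simp_rw [sum_comm (s := (univ : Finset V)) (t := X.level d)]
  refine sum_congr rfl fun s _ => ?_
  rw [sum_div, mul_sum, ← filter_univ_mem s, sum_filter, filter_univ_mem]
  refine sum_congr rfl fun u _ => ?_
  by_cases hu : u ∈ s
  · simp only [hu, true_and, if_true]
    rw [← sum_filter, filter_univ_mem, sum_div, mul_sum]
  · simp [hu]

/-- A facet through `u` contains `d - 1` edges at `u`, and `(d - 1) / d.choose 2 = 2 / d`. Thus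
having mean zero under `Π_1` is the orthogonality required by the spectral bound. -/
theorem weightedDegree_skeletonWeight_empty [Fintype V] (X : MeasuredComplex V d) (hd : 2 ≤ d)
    (u : X.LinkVertex ∅) :
    weightedDegree (X.skeletonWeight ∅) u = 2 * X.levelMeasure 1 {u.1} := by
  let e : X.LinkVertex ∅ ≃ V := Equiv.subtypeUnivEquiv X.singleton_mem_link_empty
  have h1 : weightedDegree (X.skeletonWeight ∅) u = ∑ v : V, ∑ s ∈ X.level d,
      if u.1 ∈ s ∧ v ∈ s.erase u.1 then X.top s / (d.choose 2 : ℝ) else 0 :=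
    Fintype.sum_equiv e _ _ fun v => X.skeletonWeight_empty hd u v
  have hd' : (2 : ℝ) ≤ d := by exact_mod_cast hd
  rw [h1, X.levelMeasure_eq (by omega) (card_singleton u.1), sum_comm, sum_div, mul_sum]
  refine sum_congr rfl fun s hs => ?_
  by_cases hu : u.1 ∈ s
  · simp only [hu, true_and, singleton_subset_iff, if_true]
    rw [← sum_filter, filter_univ_mem, sum_const, card_erase_of_mem hu, X.card_of_mem_level hs,
      nsmul_eq_mul, Nat.cast_choose_two, Nat.choose_one_right, Nat.cast_sub (by omega)]
    have : (d : ℝ) - 1 ≠ 0 := by linarith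
    push_cast
    field_simp
  · simp [hu]

/-- The average of a sign function over a random facet has variance at most `1 / d + γ`. -/
theorem IsHDX.variance_facetAverage_le [Fintype V] {X : MeasuredComplex V d} {γ : ℝ}
    (hX : X.IsHDX γ) (hγ : γ < 1) (hd : 2 ≤ d) (f : V → ℝ) (hf : ∀ v, f v ^ 2 = 1) {μ : ℝ}
    (hμ : ∑ v, X.levelMeasure 1 {v} * f v = μ) :
    ∑ s ∈ X.level d, X.top s * ((∑ v ∈ s, f v) / d - μ) ^ 2 ≤ 1 / d + γ := by
  have hd' : (2 : ℝ) ≤ d := by exact_mod_cast hd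
  have hempty : ∅ ∈ X.level 0 := by
    have : (X.level d).Nonempty := by
      rw [nonempty_iff_ne_empty]
      intro h
      have := X.top_sum
      simp [h] at this
    obtain ⟨s, hs⟩ := this
    exact X.mem_level_of_subset hs (empty_subset s)
  have hσ := hX 0 (by omega) ∅ hempty
  have hγ0 : 0 ≤ γ := (LinearMap.singularValues_nonneg _ _).trans hσ
  have htotal : ∑ v, X.levelMeasure 1 {v} = 1 := by
    have h := X.sum_levelMeasure_one_mul (by omega) (fun _ => 1)
    simp only [mul_one] at h
    rw [h]
    refine Eq.trans ?_ X.top_sum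
    refine sum_congr rfl fun s hs => ?_
    rw [sum_const, X.card_of_mem_level hs, nsmul_eq_mul, mul_one, div_self (by linarith), mul_one]
  set h : V → ℝ := fun v => f v - μ with hh
  have hmean : ∑ v, X.levelMeasure 1 {v} * h v = 0 := by
    simp only [hh, mul_sub, sum_sub_distrib, hμ, ← sum_mul, htotal]
    ring
  have hvar : ∑ v, X.levelMeasure 1 {v} * h v ^ 2 ≤ 1 := by
    have : ∑ v, X.levelMeasure 1 {v} * h v ^ 2 = 1 - μ ^ 2 := by
      have hexp (v : V) : X.levelMeasure 1 {v} * h v ^ 2 =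
          (1 + μ ^ 2) * X.levelMeasure 1 {v} - 2 * μ * (X.levelMeasure 1 {v} * f v) := by
        simp only [hh]
        linear_combination X.levelMeasure 1 {v} * hf v
      simp_rw [hexp]
      rw [sum_sub_distrib, ← mul_sum, ← mul_sum, htotal, hμ]
      ring
    rw [this]
    nlinarith [sq_nonneg μ]
  let e : X.LinkVertex ∅ ≃ V := Equiv.subtypeUnivEquiv X.singleton_mem_link_empty
  have htrans (F : V → ℝ) : ∑ u, weightedDegree (X.skeletonWeight ∅) u * F u.1 =
      2 * ∑ v, X.levelMeasure 1 {v} * F v := by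
    rw [mul_sum]
    refine Fintype.sum_equiv e _ _ fun u => ?_
    rw [X.weightedDegree_skeletonWeight_empty hd]
    simp only [e, Equiv.subtypeUnivEquiv_apply]
    ring
  have hquad := quadraticForm_le_of_secondSingularValue_le (X.skeletonWeight ∅)
    (fun u v => by
      rw [X.skeletonWeight_empty hd, X.skeletonWeight_empty hd]
      exact sum_congr rfl fun s _ => by
        refine if_congr ?_ rfl rfl
        simp only [mem_erase]
        tauto)
    (fun u v => by
      rw [X.skeletonWeight_empty hd]
      refine sum_nonneg fun s _ => ?_
      split_ifs
      · exact div_nonneg (X.top_nonneg s) (Nat.cast_nonneg _)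
      · exact le_rfl) hγ hσ (fun u => h u.1)
    (by rw [htrans h, hmean, mul_zero])
  rw [htrans (fun v => h v ^ 2), X.sum_skeletonWeight_empty_mul hd (fun u v => h u * h v)] at hquad
  -- Expand the square of the centred sum into diagonal terms and ordered pairs; the factor `(d - 1)
  -- / (2d)` is `d.choose 2 / d ^ 2`.
  have hdecomp : ∑ s ∈ X.level d, X.top s * ((∑ v ∈ s, f v) / d - μ) ^ 2 =
      1 / d * (∑ v, X.levelMeasure 1 {v} * h v ^ 2) + (d - 1) / (2 * d) *
        ∑ s ∈ X.level d, X.top s *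
          ((∑ u ∈ s, ∑ v ∈ s.erase u, h u * h v) / (d.choose 2 : ℝ)) := by
    rw [X.sum_levelMeasure_one_mul (by omega), mul_sum, mul_sum, ← sum_add_distrib]
    refine sum_congr rfl fun s hs => ?_
    have h1 : (∑ v ∈ s, f v) / d - μ = (∑ v ∈ s, h v) / d := by
      simp only [hh, sum_sub_distrib, sum_const, X.card_of_mem_level hs, nsmul_eq_mul]
      field_simp
    have h2 : (∑ v ∈ s, h v) ^ 2 =
        ∑ v ∈ s, h v ^ 2 + ∑ u ∈ s, ∑ v ∈ s.erase u, h u * h v := by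
      rw [sq, sum_mul_sum, ← sum_add_distrib]
      refine sum_congr rfl fun u hu => ?_
      rw [← add_sum_erase s _ hu, sq]
    rw [h1, div_pow, h2, Nat.cast_choose_two]
    have : (d : ℝ) - 1 ≠ 0 := by linarith
    field_simp
  rw [hdecomp]
  have hb : γ * (2 * ∑ v, X.levelMeasure 1 {v} * h v ^ 2) ≤ 2 * γ := by nlinarith
  calc _ ≤ 1 / (d : ℝ) * 1 + (d - 1) / (2 * d) * (2 * γ) := by
        gcongr
        · exact div_nonneg (by linarith) (by linarith)
        · exact hquad.trans hb
    _ ≤ 1 / d + γ := by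
        have : ((d : ℝ) - 1) / (2 * d) * (2 * γ) = (d - 1) / d * γ := by field_simp
        rw [this, mul_one]
        have h3 : ((d : ℝ) - 1) / d ≤ 1 := by
          rw [div_le_one (by linarith)]; linarith
        have := mul_le_of_le_one_left hγ0 h3
        linarith

end MeasuredComplex

/-! ### Signs and the parity sampler -/

theorem neg_one_pow_val_add (a b : ZMod 2) :
    (-1 : ℝ) ^ (a + b).val = (-1) ^ a.val * (-1) ^ b.val := by
  rw [ZMod.val_add, ← neg_one_pow_eq_pow_mod_two, pow_add]

theorem neg_one_pow_val_sum {V : Type*} [DecidableEq V] (t : Finset V) (z : V → ZMod 2) :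
    (-1 : ℝ) ^ (∑ v ∈ t, z v).val = ∏ v ∈ t, (-1 : ℝ) ^ (z v).val := by
  induction t using Finset.induction_on with
  | empty => simp
  | insert a s ha ih => rw [sum_insert ha, prod_insert ha, neg_one_pow_val_add, ih]

theorem MeasuredComplex.IsHDX.isParitySampler {V : Type*} [Fintype V] [DecidableEq V] {d : ℕ}
    {X : MeasuredComplex V d} {γ : ℝ} (hX : X.IsHDX γ) {β₀ β θ : ℝ} {k : ℕ} (hβ : 0 < β)
    (hβ₀ : 0 < β₀) (hθ : 0 < θ) (hγ : γ < 1) (hγd : γ ≤ 1 / d) (hd2 : 2 ≤ d) (hkd : k ≤ d)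
    (hpow : ((1 + θ) * β₀) ^ k ≤ β / 3) (hd₁ : 3 * (k : ℝ) ^ 2 / β ≤ d)
    (hd₂ : 6 / (θ ^ 2 * β₀ ^ 2 * β) ≤ d) :
    X.IsParitySampler k (X.directSum k) β₀ β := by
  intro z hz
  have hd' : (0 : ℝ) < d := by exact_mod_cast (by omega : 0 < d)
  set f : V → ℝ := fun v => (-1 : ℝ) ^ (z v).val with hf
  have hfabs (v : V) : |f v| ≤ 1 := by simp [hf]
  have hfsq (v : V) : f v ^ 2 = 1 := by simp [hf, ← pow_mul, mul_comm]
  set μ := ∑ v, X.levelMeasure 1 {v} * f v with hμ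
  have hμβ : |μ| ≤ β₀ := hz
  set a : Finset V → ℝ := fun s => (∑ v ∈ s, f v) / d with ha
  have hvar : ∑ s ∈ X.level d, X.top s * (a s - μ) ^ 2 ≤ θ ^ 2 * β₀ ^ 2 * (β / 3) := by
    refine (hX.variance_facetAverage_le hγ hd2 f hfsq hμ.symm).trans ?_
    rw [div_le_iff₀ (by positivity)] at hd₂
    calc 1 / (d : ℝ) + γ ≤ 2 / d := by rw [show (2 : ℝ) / d = 1 / d + 1 / d by ring]; linarith
      _ ≤ _ := by rw [div_le_iff₀ hd']; linarith
  have hk : (k : ℝ) * (k - 1) / d ≤ β / 3 := by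
    rw [div_le_iff₀ hβ] at hd₁
    rw [div_le_iff₀ hd']
    nlinarith [Nat.cast_nonneg (α := ℝ) k]
  have hlift : bias (fun s : X.level k => X.levelMeasure k s.1) (X.directSum k z) =
      |∑ s ∈ X.level d, X.top s *
        ((∑ t ∈ s.powersetCard k, ∏ v ∈ t, f v) / (d.choose k : ℝ))| := by
    rw [bias, ← X.sum_levelMeasure_mul hkd (fun t => ∏ v ∈ t, f v),
      ← sum_coe_sort (X.level k) fun t => X.levelMeasure k t * ∏ v ∈ t, f v]
    congr 1
    refine sum_congr rfl fun t _ => ?_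
    rw [MeasuredComplex.directSum, neg_one_pow_val_sum]
  have hfacet (s) (hs : s ∈ X.level d) :
      |(∑ t ∈ s.powersetCard k, ∏ v ∈ t, f v) / (d.choose k : ℝ)| ≤
        2 * (β / 3) + (a s - μ) ^ 2 / (θ ^ 2 * β₀ ^ 2) := by
    have hcard := X.card_of_mem_level hs
    have hsample := abs_average_prod_powersetCard_sub_pow_le s hcard f hfabs k hkd
    have ha1 : |a s| ≤ 1 := by
      rw [ha, abs_div, Nat.abs_cast]
      refine div_le_one_of_le₀ ?_ hd'.le
      refine (abs_sum_le_sum_abs _ _).trans ((sum_le_sum fun t _ => hfabs t).trans ?_)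
      simp [hcard]
    have hpowa : |a s| ^ k ≤ β / 3 + (a s - μ) ^ 2 / (θ ^ 2 * β₀ ^ 2) := by
      -- Chebyshev in pointwise form: on a bad facet the quadratic term is at least `1`, which
      -- dominates the trivial bound `|a s| ^ k ≤ 1`.
      by_cases hgood : |a s - μ| ≤ θ * β₀
      · have h1 : |a s| ≤ (1 + θ) * β₀ := by
          have := abs_sub_abs_le_abs_sub (a s) μ
          linarith
        have h2 := (pow_le_pow_left₀ (abs_nonneg _) h1 k).trans hpow
        have : 0 ≤ (a s - μ) ^ 2 / (θ ^ 2 * β₀ ^ 2) := by positivity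
        linarith
      · have h1 : 1 ≤ (a s - μ) ^ 2 / (θ ^ 2 * β₀ ^ 2) := by
          rw [one_le_div (by positivity), ← mul_pow, ← sq_abs (a s - μ)]
          exact pow_le_pow_left₀ (by positivity) (not_le.1 hgood).le 2
        have h2 : |a s| ^ k ≤ 1 := pow_le_one₀ (abs_nonneg _) ha1
        linarith
    rw [← abs_pow] at hpowa
    have := abs_sub_abs_le_abs_sub
      ((∑ t ∈ s.powersetCard k, ∏ v ∈ t, f v) / (d.choose k : ℝ)) (a s ^ k)
    linarith
  rw [hlift]
  calc _ ≤ ∑ s ∈ X.level d, X.top s * (2 * (β / 3) + (a s - μ) ^ 2 / (θ ^ 2 * β₀ ^ 2)) := by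
        refine (abs_sum_le_sum_abs _ _).trans (sum_le_sum fun s hs => ?_)
        rw [abs_mul, abs_of_nonneg (X.top_nonneg s)]
        exact mul_le_mul_of_nonneg_left (hfacet s hs) (X.top_nonneg s)
    _ = 2 * (β / 3) +
        (∑ s ∈ X.level d, X.top s * (a s - μ) ^ 2) / (θ ^ 2 * β₀ ^ 2) := by
        simp_rw [mul_add]
        rw [sum_add_distrib, ← sum_mul, X.top_sum, one_mul, sum_div]
        simp_rw [mul_div_assoc]
    _ ≤ 2 * (β / 3) + β / 3 := by
        refine add_le_add_right ?_ _
        rw [div_le_iff₀ (by positivity)]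
        linarith
    _ = β := by ring

theorem mainTheorem7 :
    ∃ C : ℝ, 0 < C ∧
      ∀ (β₀ β θ γ : ℝ) (k d : ℕ),
        0 < β → β ≤ β₀ → β₀ < 1 →
        0 < θ → θ < 1 / β₀ - 1 →
        Real.logb ((1 + θ) * β₀) (β / 3) ≤ (k : ℝ) →
        max (3 * (k : ℝ) ^ 2 / β) (6 / (θ ^ 2 * β₀ ^ 2 * β)) ≤ (d : ℝ) →
        γ ≤ C / (d : ℝ) ^ 2 →
        ∀ (V : Type*) [Fintype V] [DecidableEq V] (X : MeasuredComplex V d),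
          X.IsHDX γ → X.IsParitySampler k (X.directSum k) β₀ β := by
  -- `C = 1` suffices, since the variance bound only needs `γ ≤ 1 / d`.
  refine ⟨1, one_pos, ?_⟩
  intro β₀ β θ γ k d hβ hββ₀ hβ₀1 hθ hθβ₀ hk hd hγ V _ _ X hX
  have hβ₀ : 0 < β₀ := hβ.trans_le hββ₀
  have hbase : (1 + θ) * β₀ < 1 := by
    rw [← lt_div_iff₀ hβ₀]; linarith
  have hbase0 : 0 < (1 + θ) * β₀ := by positivity
  obtain ⟨hd₁, hd₂⟩ := max_le_iff.1 hd
  -- The base is below `1`, so the logarithm reverses the inequality.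
  have hpow : ((1 + θ) * β₀) ^ k ≤ β / 3 := by
    rw [Real.logb_le_iff_le_rpow_of_base_lt_one hbase0 hbase (by positivity),
      Real.rpow_natCast] at hk
    exact hk
  -- As `θβ₀ < 1` and `β < 1`, the second bound on `d` is at least `6`. This gives `d ≥ 2`, so that
  -- facets contain pairs, and `γ ≤ 1 / d < 1`.
  have hd6 : (6 : ℝ) ≤ d := by
    have h1 : θ * β₀ < 1 := by nlinarith
    have h2 : θ ^ 2 * β₀ ^ 2 * β ≤ 1 := by
      rw [← mul_pow]
      exact mul_le_one₀ (pow_le_one₀ (by positivity) h1.le) hβ.le (by linarith)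
    refine le_trans ?_ hd₂
    rw [le_div_iff₀ (by positivity)]
    linarith
  have hd2 : 2 ≤ d := by
    have : 6 ≤ d := by exact_mod_cast hd6
    omega
  have hkd : k ≤ d := by
    rcases Nat.eq_zero_or_pos k with rfl | hk0
    · omega
    have hk1 : (1 : ℝ) ≤ k := by exact_mod_cast hk0
    have : (k : ℝ) ≤ d := by
      rw [div_le_iff₀ hβ] at hd₁
      nlinarith
    exact_mod_cast this
  have hγd : γ ≤ 1 / d := hγ.trans (one_div_le_one_div_of_le (by linarith) (by nlinarith))
  have hγ1 : γ < 1 := hγd.trans_lt (by rw [div_lt_one] <;> linarith)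
  exact hX.isParitySampler hβ hβ₀ hθ hγ1 hγd hd2 hkd hpow hd₁ hd₂
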